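/- **Theorem.** Let $n \ge 1$ and let $\lambda = (\lambda_1 > \lambda_2 > \dots > \lambda_\ell > 0)$ be a partition of $n$ with distinct parts. Let $[\lambda]^* = \{(i,j) \in \mathbb{Z}^2 : 1 \le i \le \ell,\ i \le j \le \lambda_i + i - 1\}$ be its shifted Young diagram, and let $\mathcal C^*[\lambda]$ be the set of shifted corners, i.e. of those $(i,j) \in [\lambda]^*$ with $(i+1,j) \notin [\lambda]^*$ and $(i,j+1) \notin [\lambda]^*$. For $(i,j) \in [\lambda]^*$ let $h^*_{ij}$ be the shifted hook length: the number of squares of $[\lambda]^*$ that lie in row $i$ weakly to the right of $(i,j)$, or in column $j$ weakly below $(i,j)$, or in row $j+1$ (each square counted once). Put $h^*_{ij} = 1$ if $(i,j) \notin [\lambda]^*$. Write $$P = \prod_{(i,j) \in [\lambda]^* \setminus \mathcal C^*[\lambda]} (h^*_{ij} - 1), \qquad P_{r,s} = \prod_{\substack{(i,j) \in [\lambda]^* \setminus \mathcal C^*[\lambda] \\ i \ne r,\ j \ne r-1,\ j \ne s}} (h^*_{ij} - 1),$$ where empty products are $1$. Then the following three identities hold: $$n \cdot P = \sum_{(r,s)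 \in \mathcal C^*[\lambda]} P_{r,s} \prod_{i=1}^{r-1} h^*_{is} \prod_{j=r}^{s-1} h^*_{rj} \prod_{i=1}^{r-1} h^*_{i,r-1},$$ $$\lambda_1 \cdot P = \sum_{(r,s) \in \mathcal C^*[\lambda]} \left(h^*_{1,r-1} + h^*_{1s} - 1\right) P_{r,s} \prod_{i=2}^{r-1} h^*_{is} \prod_{j=r}^{s-1} h^*_{rj} \prod_{i=2}^{r-1} h^*_{i,r-1},$$ $$P = \sum_{(r,s) \in \mathcal C^*[\lambda]} \left(h^*_{1s} h^*_{2,r-1} + (h^*_{1,r-1} - 1)(h^*_{2s} - 1)\right) P_{r,s} \prod_{i=3}^{r-1} h^*_{is} \prod_{j=\max\{r,2\}}^{s-1} h^*_{rj} \prod_{i=3}^{r-1} h^*_{i,r-1}.$$ -/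

import Mathlib

namespace Nat.Partition

variable {n : ℕ}

/-- The `i`-th largest part `λ_i` of a partition, counted from `i = 1`
(and `0` if `i = 0` or if `i` exceeds the number of parts). -/
def nthPart (p : n.Partition) (i : ℕ) : ℕ :=
  if i = 0 then 0 else (p.parts.sort (· ≥ ·)).getD (i - 1) 0

/-- The shifted Young diagram `{(i, j) : 1 ≤ i ≤ ℓ, i ≤ j ≤ λ_i + i - 1}`, where `ℓ` is the number
of parts. -/
def shiftedDiagram (p : n.Partition) : Finset (ℕ × ℕ) :=
  (Finset.Icc 1 p.parts.card).biUnion fun i =>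
    (Finset.Icc i (p.nthPart i + i - 1)).image fun j => (i, j)

/-- The shifted hook of `z = (i, j)`: the squares of the diagram in row `i` weakly to the right
of `z`, in column `j` weakly below `z`, and in row `j + 1`. -/
def shiftedHook (p : n.Partition) (z : ℕ × ℕ) : Finset (ℕ × ℕ) :=
  p.shiftedDiagram.filter fun w =>
    (w.1 = z.1 ∧ z.2 ≤ w.2) ∨ (w.2 = z.2 ∧ z.1 ≤ w.1) ∨ w.1 = z.2 + 1

/-- The shifted hook length `h*_{ij}`, an integer, with the convention that it is `1` for squares
outside of the diagram. -/
def shiftedHookLength (p : n.Partition) (i j : ℕ) : ℤ :=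
  if (i, j) ∈ p.shiftedDiagram then ((p.shiftedHook (i, j)).card : ℤ) else 1

/-- The shifted corners: squares `(i, j)` of the diagram such that neither `(i + 1, j)` nor
`(i, j + 1)` is in the diagram. -/
def shiftedCorners (p : n.Partition) : Finset (ℕ × ℕ) :=
  p.shiftedDiagram.filter fun z =>
    (z.1 + 1, z.2) ∉ p.shiftedDiagram ∧ (z.1, z.2 + 1) ∉ p.shiftedDiagram

/-- The product of `h*_{ij} - 1` over all squares of the diagram that are not corners. -/
def puncturedProd (p : n.Partition) : ℤ :=
  ∏ z ∈ p.shiftedDiagram \ p.shiftedCorners, (p.shiftedHookLength z.1 z.2 - 1)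

/-- The product of `h*_{ij} - 1` over all non-corner squares `(i, j)` of the diagram with
`i ≠ r` and `j ≠ r - 1, s`. Here `r ≥ 1`, so the subtraction is the true one. -/
def puncturedProdAway (p : n.Partition) (r s : ℕ) : ℤ :=
  ∏ z ∈ (p.shiftedDiagram \ p.shiftedCorners).filter
      (fun z => z.1 ≠ r ∧ z.2 ≠ r - 1 ∧ z.2 ≠ s),
    (p.shiftedHookLength z.1 z.2 - 1)

end Nat.Partition

/-! Dividing the summand of the first identity at a corner `(r, s)` by `P` leaves the product of `h
/ (h - 1)` over row `r` left of the corner and over columns `s` and `r - 1` above row `r`. Hook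
lengths computed from the parts make this ratio collapse to `w_r = λ_r ∏_{j ≠ r} (λ_j + 1 - λ_r)(λ_j
+ λ_r) / ((λ_j - λ_r)(λ_j + λ_r - 1))`, with one factor for each other row
(`prod_hook_eq_rowWeight_mul`).

With `a_j = 2 λ_j` and `y_j = λ_j (λ_j - 1)`, each factor is `1 + a_j / (y_j - y_r)`, so a partial
fraction identity gives `∑ w_r = ∑ λ_r = n` over all rows. A row that does not end in a corner has
`λ_{r+1} + 1 = λ_r`, hence weight `0`, so the sum is over corners.

The same holds for the rows from `m` on, with total `∑_{i ≥ m} λ_i`. The second identity subtracts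
the case `m = 2` from `m = 1`, leaving `λ_1`; the third subtracts `m = 3`, leaving `λ_1 + λ_2`, a
common factor that is then cancelled. -/

/-! ### Partial fractions and a telescoping product -/

/-- The partial fraction expansion of `∏ (1 + a j / (y j - t))`. -/
theorem Finset.prod_one_add_div_eq {ι K : Type*} [DecidableEq ι] [Field K] (a y : ι → K)
    (s : Finset ι) (hy : Set.InjOn y s) (t : K) (ht : ∀ j ∈ s, y j ≠ t) :
    ∏ j ∈ s, (1 + a j / (y j - t)) =
      1 + ∑ r ∈ s, a r * (∏ j ∈ s.erase r, (1 + a j / (y j - y r))) / (y r - t) := by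
  induction s using Finset.induction_on generalizing t with
  | empty => simp
  | insert k s hk ih =>
    have hys : Set.InjOn y s := hy.mono (by simp)
    have hne : ∀ j ∈ s, y j ≠ y k := fun j hj h =>
      hk (hy (by simp [hj]) (by simp) h ▸ hj)
    have ht' : ∀ j ∈ s, y j - t ≠ 0 := fun j hj => sub_ne_zero.2 (ht j (by simp [hj]))
    have htk : y k - t ≠ 0 := sub_ne_zero.2 (ht k (by simp))
    have hsum : ∑ r ∈ s, a r * (∏ j ∈ (insert k s).erase r, (1 + a j / (y j - y r))) / (y r - t) =
        ∑ r ∈ s, a r * (∏ j ∈ s.erase r, (1 + a j / (y j - y r))) / (y r - t) *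
          (1 + a k / (y k - y r)) := by
      refine Finset.sum_congr rfl fun r hr => ?_
      have hkr : k ≠ r := fun h => hk (h ▸ hr)
      rw [Finset.erase_insert_of_ne hkr, Finset.prod_insert (by simp [hk])]
      ring
    -- The expansion over `s` is used twice, at `t` and at `y k`; what remains is, term by term, the
    -- splitting of `1 / ((y k - t) (y r - t))`.
    rw [Finset.prod_insert hk, Finset.sum_insert hk, Finset.erase_insert hk, hsum,
      ih hys t fun j hj => ht j (by simp [hj]), ih hys (y k) hne]
    rw [mul_add, mul_one, mul_add, mul_one, add_div, Finset.mul_sum, Finset.mul_sum,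
      Finset.sum_div, add_assoc, add_assoc, ← Finset.sum_add_distrib]
    congr 2
    refine Finset.sum_congr rfl fun r hr => ?_
    have h1 := ht' r hr
    have h2 : y r - y k ≠ 0 := sub_ne_zero.2 (hne r hr)
    have h3 : y k - y r ≠ 0 := sub_ne_zero.2 (hne r hr).symm
    have h4 : a k / (y k - y r) = - (a k / (y r - y k)) := by
      rw [← neg_sub (y r), div_neg]
    rw [h4]
    field_simp
    ring

/-- Adding an index `k` multiplies each old term by `1 + a k / (y k - y r)`. By the partial fraction
expansion at `t = y k`, the resulting corrections cancel all of the new term except `a k`. -/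
theorem Finset.sum_mul_prod_one_add_div {ι K : Type*} [DecidableEq ι] [Field K] (a y : ι → K)
    (s : Finset ι) (hy : Set.InjOn y s) :
    ∑ r ∈ s, a r * ∏ j ∈ s.erase r, (1 + a j / (y j - y r)) = ∑ r ∈ s, a r := by
  induction s using Finset.induction_on with
  | empty => simp
  | insert k s hk ih =>
    have hys : Set.InjOn y s := hy.mono (by simp)
    have hne : ∀ j ∈ s, y j ≠ y k := fun j hj h =>
      hk (hy (by simp [hj]) (by simp) h ▸ hj)
    have hsum : ∑ r ∈ s, a r * ∏ j ∈ (insert k s).erase r, (1 + a j / (y j - y r)) =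
        ∑ r ∈ s, (a r * (∏ j ∈ s.erase r, (1 + a j / (y j - y r))) -
          a k * (a r * (∏ j ∈ s.erase r, (1 + a j / (y j - y r))) / (y r - y k))) := by
      refine Finset.sum_congr rfl fun r hr => ?_
      have hkr : k ≠ r := fun h => hk (h ▸ hr)
      rw [Finset.erase_insert_of_ne hkr, Finset.prod_insert (by simp [hk]),
        ← neg_sub (y r), div_neg]
      ring
    rw [Finset.sum_insert hk, Finset.sum_insert hk, Finset.erase_insert hk, hsum,
      Finset.prod_one_add_div_eq a y s hys _ hne, Finset.sum_sub_distrib, ih hys,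
      ← Finset.mul_sum]
    ring

theorem Finset.prod_Ico_sub_div {c : ℚ} {a b : ℕ} (hab : a ≤ b) (h : (b : ℚ) < c) :
    ∏ j ∈ Finset.Ico a b, ((c - j) / (c - j - 1)) = (c - a) / (c - b) := by
  induction b, hab using Nat.le_induction with
  | base => rw [Finset.Ico_self, Finset.prod_empty, div_self (by linarith)]
  | succ b hb ih =>
    push_cast at h
    rw [Finset.prod_Ico_succ_top hb, ih (by linarith)]
    have h1 : c - b ≠ 0 := by linarith
    have h2 : c - b - 1 ≠ 0 := by linarith
    rw [div_mul_div_cancel₀ h1]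
    push_cast
    ring

/-! ### Parts, squares and corners -/

namespace Nat.Partition

variable {n : ℕ}

theorem nthPart_of_mem {p : n.Partition} {i : ℕ} (h1 : 1 ≤ i) (h2 : i ≤ p.parts.card) :
    p.nthPart i = (p.parts.sort (· ≥ ·))[i - 1]'(by simp; omega) := by
  have h : i - 1 < (p.parts.sort (· ≥ ·)).length := by simp; omega
  rw [nthPart, if_neg (by omega), List.getD_eq_getElem _ _ h]

theorem nthPart_of_card_lt {p : n.Partition} {i : ℕ} (h : p.parts.card < i) :
    p.nthPart i = 0 := by
  rw [nthPart, if_neg (by omega), List.getD_eq_default]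
  simp; omega

theorem nthPart_pos {p : n.Partition} {i : ℕ} (h1 : 1 ≤ i) (h2 : i ≤ p.parts.card) :
    0 < p.nthPart i := by
  rw [nthPart_of_mem h1 h2]
  apply p.parts_pos
  rw [← Multiset.mem_sort (· ≥ ·)]
  exact List.getElem_mem _

theorem nthPart_lt {p : n.Partition} (hp : p.parts.Nodup) {i j : ℕ} (h1 : 1 ≤ i) (hij : i < j)
    (h2 : j ≤ p.parts.card) : p.nthPart j < p.nthPart i := by
  rw [nthPart_of_mem h1 (by omega), nthPart_of_mem (by omega) h2]
  have hs := Multiset.pairwise_sort p.parts (· ≥ ·)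
  have hn : (p.parts.sort (· ≥ ·)).Nodup := by
    rw [← Multiset.coe_nodup, Multiset.sort_eq]; exact hp
  have hl : j - 1 < (p.parts.sort (· ≥ ·)).length := by simp; omega
  have h := List.pairwise_iff_getElem.1 hs (i - 1) (j - 1) (by omega) hl (by omega)
  refine lt_of_le_of_ne h fun h' => ?_
  have := (hn.getElem_inj_iff).1 h'
  omega

theorem sum_nthPart (p : n.Partition) :
    ∑ i ∈ Finset.Icc 1 p.parts.card, p.nthPart i = n := by
  have h : (p.parts.sort (· ≥ ·)).sum = n := by
    rw [← Multiset.sum_coe, Multiset.sort_eq, p.parts_sum]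
  have hc : (p.parts.sort (· ≥ ·)).length = p.parts.card := by simp
  rw [← Finset.Ico_add_one_right_eq_Icc, Finset.sum_Ico_eq_sum_range, Nat.add_sub_cancel,
    ← hc, Finset.sum_range]
  conv_rhs => rw [← h, ← Fin.sum_univ_getElem]
  refine Finset.sum_congr rfl fun i _ => ?_
  rw [nthPart_of_mem (by omega) (by omega)]
  simp

theorem mem_shiftedDiagram {p : n.Partition} {i j : ℕ} :
    (i, j) ∈ p.shiftedDiagram ↔
      1 ≤ i ∧ i ≤ p.parts.card ∧ i ≤ j ∧ j < p.nthPart i + i := by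
  simp only [shiftedDiagram, Finset.mem_biUnion, Finset.mem_image, Finset.mem_Icc, Prod.mk.injEq]
  constructor
  · rintro ⟨a, ⟨h1, h2⟩, b, ⟨h3, h4⟩, rfl, rfl⟩
    have := nthPart_pos h1 h2
    omega
  · rintro ⟨h1, h2, h3, h4⟩
    exact ⟨i, ⟨h1, h2⟩, j, ⟨h3, by omega⟩, rfl, rfl⟩

theorem mem_shiftedCorners {p : n.Partition} (hp : p.parts.Nodup) {r s : ℕ} :
    (r, s) ∈ p.shiftedCorners ↔
      1 ≤ r ∧ r ≤ p.parts.card ∧ s + 1 = p.nthPart r + r ∧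
        (r < p.parts.card → p.nthPart (r + 1) + 1 < p.nthPart r) := by
  simp only [shiftedCorners, Finset.mem_filter, mem_shiftedDiagram]
  constructor
  · rintro ⟨⟨h1, h2, h3, h4⟩, h5, h6⟩
    have hs : s + 1 = p.nthPart r + r := by omega
    refine ⟨h1, h2, hs, fun h => ?_⟩
    have := nthPart_pos (p := p) (i := r + 1) (by omega) h
    have := nthPart_lt hp h1 (Nat.lt_add_one r) h
    omega
  · rintro ⟨h1, h2, h3, h4⟩
    have := nthPart_pos (p := p) h1 h2
    refine ⟨by omega, fun h => ?_, by omega⟩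
    have := h4 (by omega)
    omega

/-- Strictly decreasing parts offset the shift: the right ends of the rows move weakly left going
down. -/
theorem nthPart_add_le {p : n.Partition} (hp : p.parts.Nodup) {i j : ℕ} (h1 : 1 ≤ i)
    (hij : i ≤ j) (h2 : j ≤ p.parts.card) : p.nthPart j + j ≤ p.nthPart i + i := by
  induction j, hij using Nat.le_induction with
  | base => exact le_rfl
  | succ k hk ih =>
    have := ih (by omega)
    have := nthPart_lt hp (i := k) (j := k + 1) (by omega) (by omega) h2
    omega

/-- Every row reaches column `ℓ`, the number of parts. Columns before `ℓ` therefore run down to the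
diagonal, and hook lengths have different forms on the two sides of `ℓ`. -/
theorem card_lt_nthPart_add {p : n.Partition} (hp : p.parts.Nodup) {i : ℕ} (h1 : 1 ≤ i)
    (h2 : i ≤ p.parts.card) : p.parts.card < p.nthPart i + i := by
  have := nthPart_add_le hp h1 h2 le_rfl
  have := nthPart_pos (p := p) (i := p.parts.card) (by omega) le_rfl
  omega

/-! ### Shifted hook lengths -/

/-- The shifted hook length in terms of the parts, where `k` is the lowest row meeting
column `j`. -/
theorem shiftedHookLength_eq {p : n.Partition} (hp : p.parts.Nodup) {i j k : ℕ} (hi : 1 ≤ i)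
    (hik : i ≤ k) (hk : k ≤ p.parts.card) (hkj : k ≤ j) (hj : j < p.nthPart k + k)
    (hlow : k + 1 ≤ p.parts.card → k + 1 ≤ j → p.nthPart (k + 1) + (k + 1) ≤ j) :
    p.shiftedHookLength i j = p.nthPart i + k - j + p.nthPart (j + 1) := by
  have hE := nthPart_add_le hp hi hik hk
  have hmem : (i, j) ∈ p.shiftedDiagram := mem_shiftedDiagram.2 (by omega)
  -- Three disjoint pieces: the arm with the square itself (`λ_i + i - j` squares), the leg (`k -
  -- i`), and all of row `j + 1`.
  have hset : p.shiftedHook (i, j) =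
      ((Finset.Ico j (p.nthPart i + i)).image (fun b => (i, b)) ∪
        (Finset.Ioc i k).image (fun a => (a, j))) ∪
      (Finset.Ico (j + 1) (p.nthPart (j + 1) + (j + 1))).image (fun b => (j + 1, b)) := by
    ext ⟨a, b⟩
    simp only [shiftedHook, Finset.mem_filter, Finset.mem_union, Finset.mem_image,
      Finset.mem_Ico, Finset.mem_Ioc, Prod.mk.injEq, mem_shiftedDiagram]
    constructor
    · rintro ⟨⟨h1, h2, h3, h4⟩, h⟩
      rcases h with ⟨rfl, h⟩ | ⟨rfl, h⟩ | rfl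
      · exact Or.inl (Or.inl ⟨b, by omega, rfl, rfl⟩)
      · rcases h.eq_or_lt with rfl | h
        · exact Or.inl (Or.inl ⟨b, by omega, rfl, rfl⟩)
        · refine Or.inl (Or.inr ⟨a, ⟨h, ?_⟩, rfl, rfl⟩)
          by_contra! hka
          have := hlow (by omega) (by omega)
          have := nthPart_add_le hp (i := k + 1) (j := a) (by omega) hka h2
          omega
      · exact Or.inr ⟨b, by omega, rfl, rfl⟩
    · rintro ((⟨c, h, rfl, rfl⟩ | ⟨c, h, rfl, rfl⟩) | ⟨c, h, rfl, rfl⟩)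
      · omega
      · have := nthPart_add_le hp (i := c) (j := k) (by omega) h.2 hk
        omega
      · have : j + 1 ≤ p.parts.card := by
          by_contra! h'
          rw [nthPart_of_card_lt h'] at h
          omega
        omega
  rw [shiftedHookLength, if_pos hmem, hset, Finset.card_union_of_disjoint,
    Finset.card_union_of_disjoint, Finset.card_image_of_injective, Finset.card_image_of_injective,
    Finset.card_image_of_injective]
  · simp only [Nat.card_Ico, Nat.card_Ioc]
    omega
  · intro a b h; simpa using h
  · intro a b h; simpa using h
  · intro a b h; simpa using h
  · rw [Finset.disjoint_left]
    rintro ⟨a, b⟩ h h'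
    simp only [Finset.mem_image, Finset.mem_Ico, Finset.mem_Ioc, Prod.mk.injEq] at h h'
    obtain ⟨_, _, _, _⟩ := h
    obtain ⟨_, _, _, _⟩ := h'
    omega
  · rw [Finset.disjoint_left]
    rintro ⟨a, b⟩ h h'
    simp only [Finset.mem_union, Finset.mem_image, Finset.mem_Ico, Finset.mem_Ioc,
      Prod.mk.injEq] at h h'
    obtain ⟨_, _, _, _⟩ := h'
    obtain ⟨_, _, _, _⟩ | ⟨_, _, _, _⟩ := h <;> omega

theorem shiftedHookLength_of_lt_card {p : n.Partition} (hp : p.parts.Nodup) {i j : ℕ}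
    (hi : 1 ≤ i) (hij : i ≤ j) (hj : j < p.parts.card) :
    p.shiftedHookLength i j = p.nthPart i + p.nthPart (j + 1) := by
  have := nthPart_pos (p := p) (i := j) (by omega) hj.le
  rw [shiftedHookLength_eq hp hi hij hj.le le_rfl (by omega) (by omega)]
  ring

theorem shiftedHookLength_of_card_le {p : n.Partition} (hp : p.parts.Nodup) {i j k : ℕ}
    (hi : 1 ≤ i) (hik : i ≤ k) (hk : k ≤ p.parts.card) (hlj : p.parts.card ≤ j)
    (hj : j < p.nthPart k + k)
    (hlow : k + 1 ≤ p.parts.card → p.nthPart (k + 1) + (k + 1) ≤ j) :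
    p.shiftedHookLength i j = p.nthPart i + k - j := by
  rw [shiftedHookLength_eq hp hi hik hk (by omega) hj (fun h _ => hlow h),
    nthPart_of_card_lt (i := j + 1) (by omega)]
  simp

/-- Ensures that `h - 1` does not vanish to the left of a corner, so that ratios `h / (h - 1)` can
be cleared. -/
theorem one_lt_shiftedHookLength {p : n.Partition} {i j : ℕ} (h : (i, j) ∈ p.shiftedDiagram)
    (h' : (i, j + 1) ∈ p.shiftedDiagram) : 1 < p.shiftedHookLength i j := by
  rw [shiftedHookLength, if_pos h]
  have : 1 < (p.shiftedHook (i, j)).card := by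
    refine Finset.one_lt_card.2 ⟨(i, j), ?_, (i, j + 1), ?_, by simp⟩
    · simpa [shiftedHook] using h
    · simpa [shiftedHook] using h'
  exact_mod_cast this

/-! ### Factoring the punctured product at a corner -/

/-- Splitting off the row and the two columns of the diagram affected by removing a corner. -/
theorem puncturedProd_eq {p : n.Partition} (hp : p.parts.Nodup) {r s : ℕ}
    (hc : (r, s) ∈ p.shiftedCorners) :
    p.puncturedProd = p.puncturedProdAway r s *
      (∏ i ∈ Finset.Icc 1 (r - 1), (p.shiftedHookLength i s - 1)) *
      (∏ j ∈ Finset.Icc r (s - 1), (p.shiftedHookLength r j - 1)) *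
      (∏ i ∈ Finset.Icc 1 (r - 1), (p.shiftedHookLength i (r - 1) - 1)) := by
  obtain ⟨h1, h2, h3, h4⟩ := (mem_shiftedCorners hp).1 hc
  have hpos := nthPart_pos h1 h2
  have hset : (p.shiftedDiagram \ p.shiftedCorners).filter
        (fun z => ¬ (z.1 ≠ r ∧ z.2 ≠ r - 1 ∧ z.2 ≠ s)) =
      ((Finset.Icc 1 (r - 1)).image (fun i => (i, s)) ∪
        (Finset.Icc r (s - 1)).image (fun j => (r, j))) ∪
      (Finset.Icc 1 (r - 1)).image (fun i => (i, r - 1)) := by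
    ext ⟨i, j⟩
    simp only [Finset.mem_filter, Finset.mem_union, Finset.mem_image, Finset.mem_sdiff,
      Finset.mem_Icc, Prod.mk.injEq, mem_shiftedDiagram, mem_shiftedCorners hp]
    constructor
    · rintro ⟨⟨⟨a1, a2, a3, a4⟩, hn⟩, h⟩
      by_cases hir : i = r
      · subst hir
        exact Or.inl (Or.inr ⟨j, by omega, rfl, rfl⟩)
      by_cases hjs : j = s
      · refine Or.inl (Or.inl ⟨i, ⟨a1, ?_⟩, rfl, hjs.symm⟩)
        by_contra! hri
        have := h4 (by omega)
        have := nthPart_add_le hp (i := r + 1) (j := i) (by omega) (by omega) a2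
        omega
      · exact Or.inr ⟨i, by omega, rfl, by omega⟩
    · rintro ((⟨c, h, rfl, rfl⟩ | ⟨c, h, rfl, rfl⟩) | ⟨c, h, rfl, rfl⟩)
      · have e1 := nthPart_add_le hp (i := c) (j := c + 1) (by omega) (by omega) (by omega)
        have e2 := nthPart_add_le hp (i := c + 1) (j := r) (by omega) (by omega) (by omega)
        omega
      · omega
      · have e1 := nthPart_add_le hp (i := c) (j := r) (by omega) (by omega) (by omega)
        omega
  rw [puncturedProd, ← Finset.prod_filter_mul_prod_filter_not _
    (fun z : ℕ × ℕ => z.1 ≠ r ∧ z.2 ≠ r - 1 ∧ z.2 ≠ s), hset, Finset.prod_union, Finset.prod_union,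
    Finset.prod_image, Finset.prod_image, Finset.prod_image, puncturedProdAway]
  · ring
  · intro a _ b _ h; simpa using h
  · intro a _ b _ h; simpa using h
  · intro a _ b _ h; simpa using h
  · rw [Finset.disjoint_left]
    rintro ⟨a, b⟩ h h'
    simp only [Finset.mem_image, Finset.mem_Icc, Prod.mk.injEq] at h h'
    obtain ⟨_, _, _, _⟩ := h
    obtain ⟨_, _, _, _⟩ := h'
    omega
  · rw [Finset.disjoint_left]
    rintro ⟨a, b⟩ h h'
    simp only [Finset.mem_union, Finset.mem_image, Finset.mem_Icc, Prod.mk.injEq] at h h'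
    obtain ⟨_, _, _, _⟩ := h'
    obtain ⟨_, _, _, _⟩ | ⟨_, _, _, _⟩ := h <;> omega

/-! ### Row weights and their sum -/

/-- The contribution of row `j` to the ratio of shifted hook products attached to row `r`. -/
def rowFactor (p : n.Partition) (j r : ℕ) : ℚ :=
  ((p.nthPart j + 1 - p.nthPart r) * (p.nthPart j + p.nthPart r)) /
    ((p.nthPart j - p.nthPart r) * (p.nthPart j + p.nthPart r - 1))

/-- The weight of row `r` in the partition formed by the rows from `m` on; it is `0` if `r < m`. -/
def rowWeight (p : n.Partition) (m r : ℕ) : ℚ :=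
  if m ≤ r then
    p.nthPart r * ∏ j ∈ (Finset.Icc m p.parts.card).erase r, p.rowFactor j r
  else 0

theorem nthPart_ne {p : n.Partition} (hp : p.parts.Nodup) {i j : ℕ} (hi : 1 ≤ i) (hj : 1 ≤ j)
    (hi' : i ≤ p.parts.card) (hj' : j ≤ p.parts.card) (hij : i ≠ j) :
    p.nthPart i ≠ p.nthPart j := by
  rcases lt_or_gt_of_ne hij with h | h
  · exact (nthPart_lt hp hi h hj').ne'
  · exact (nthPart_lt hp hj h hi').ne

theorem sub_mul_add_sub_one_ne_zero {a b : ℕ} (ha : 0 < a) (hb : 0 < b) (hab : a ≠ b) :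
    ((a : ℚ) - b ≠ 0) ∧ ((a : ℚ) + b - 1 ≠ 0) := by
  refine ⟨sub_ne_zero.2 (by exact_mod_cast hab), ?_⟩
  have h1 : (1 : ℚ) ≤ a := by exact_mod_cast ha
  have h2 : (1 : ℚ) ≤ b := by exact_mod_cast hb
  intro h
  linarith

/-- With the `a` and `y` below, `(λ_j + 1 - λ_r)(λ_j + λ_r)` exceeds `y j - y r = (λ_j - λ_r)(λ_j +
λ_r - 1)` by exactly `a j`. The `y j` are distinct because the parts are distinct and positive. -/
theorem sum_rowWeight {p : n.Partition} (hp : p.parts.Nodup) {m : ℕ} (hm : 1 ≤ m) :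
    ∑ r ∈ Finset.Icc m p.parts.card, p.rowWeight m r =
      ∑ r ∈ Finset.Icc m p.parts.card, (p.nthPart r : ℚ) := by
  let a : ℕ → ℚ := fun j => 2 * p.nthPart j
  let y : ℕ → ℚ := fun j => p.nthPart j * (p.nthPart j - 1)
  have hsub : ∀ i ∈ Finset.Icc m p.parts.card, ∀ j ∈ Finset.Icc m p.parts.card, i ≠ j →
      ((p.nthPart i : ℚ) - p.nthPart j ≠ 0) ∧ ((p.nthPart i : ℚ) + p.nthPart j - 1 ≠ 0) := by
    intro i hi j hj hij
    rw [Finset.mem_Icc] at hi hj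
    exact sub_mul_add_sub_one_ne_zero (nthPart_pos (by omega) hi.2) (nthPart_pos (by omega) hj.2)
      (nthPart_ne hp (by omega) (by omega) hi.2 hj.2 hij)
  have hyd : ∀ i j, y i - y j =
      ((p.nthPart i : ℚ) - p.nthPart j) * ((p.nthPart i : ℚ) + p.nthPart j - 1) := by
    intro i j
    simp only [y]
    ring
  have hy : Set.InjOn y (Finset.Icc m p.parts.card) := by
    intro i hi j hj h
    by_contra hij
    obtain ⟨h1, h2⟩ := hsub i hi j hj hij
    exact mul_ne_zero h1 h2 (by rw [← hyd, sub_eq_zero]; exact h)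
  have key := Finset.sum_mul_prod_one_add_div a y _ hy
  have h2 : ∀ r ∈ Finset.Icc m p.parts.card,
      a r * ∏ j ∈ (Finset.Icc m p.parts.card).erase r, (1 + a j / (y j - y r)) =
        2 * p.rowWeight m r := by
    intro r hr
    rw [rowWeight, if_pos (Finset.mem_Icc.1 hr).1, ← mul_assoc]
    congr 1
    refine Finset.prod_congr rfl fun j hj => ?_
    rw [Finset.mem_erase] at hj
    obtain ⟨h1, h2⟩ := hsub j hj.2 r hr hj.1
    rw [rowFactor, hyd]
    simp only [a]
    field_simp
    ring
  rw [Finset.sum_congr rfl h2, ← Finset.mul_sum, ← Finset.mul_sum] at key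
  exact mul_left_cancel₀ two_ne_zero key

theorem rowWeight_eq_zero {p : n.Partition} {m r : ℕ} (hr : r < p.parts.card)
    (h : p.nthPart (r + 1) + 1 = p.nthPart r) : p.rowWeight m r = 0 := by
  rw [rowWeight]
  split_ifs with hm
  · rw [Finset.prod_eq_zero (i := r + 1), mul_zero]
    · simp; omega
    · have h' : (p.nthPart r : ℚ) = p.nthPart (r + 1) + 1 := by exact_mod_cast h.symm
      rw [rowFactor, h']
      simp
  · rfl

/-- Each row contains at most one corner, and rows without one have weight `0`; rows above `m` have
weight `0` by convention. -/
theorem sum_shiftedCorners_rowWeight {p : n.Partition} (hp : p.parts.Nodup) {m : ℕ}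
    (hm : 1 ≤ m) :
    ∑ c ∈ p.shiftedCorners, p.rowWeight m c.1 =
      ∑ r ∈ Finset.Icc m p.parts.card, (p.nthPart r : ℚ) := by
  rw [← sum_rowWeight hp hm]
  have hinj : Set.InjOn (Prod.fst : ℕ × ℕ → ℕ) p.shiftedCorners := by
    rintro ⟨a, b⟩ h ⟨c, d⟩ h' (rfl : a = c)
    have h1 := (mem_shiftedCorners hp).1 h
    have h2 := (mem_shiftedCorners hp).1 h'
    simp only [Prod.mk.injEq, true_and]
    omega
  rw [← Finset.sum_image (f := fun r => p.rowWeight m r) hinj]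
  have hz : ∀ r, r ∉ p.shiftedCorners.image Prod.fst → 1 ≤ r → r ≤ p.parts.card →
      p.rowWeight m r = 0 := by
    intro r hr h1 h2
    have hpos := nthPart_pos h1 h2
    by_cases hlt : r < p.parts.card
    · by_cases h : p.nthPart (r + 1) + 1 = p.nthPart r
      · exact rowWeight_eq_zero hlt h
      · have := nthPart_lt hp h1 (Nat.lt_add_one r) hlt
        exact absurd (Finset.mem_image.2 ⟨(r, p.nthPart r + r - 1),
          (mem_shiftedCorners hp).2 ⟨h1, h2, by omega, by omega⟩, rfl⟩) hr
    · exact absurd (Finset.mem_image.2 ⟨(r, p.nthPart r + r - 1),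
          (mem_shiftedCorners hp).2 ⟨h1, h2, by omega, by omega⟩, rfl⟩) hr
  have hsub : p.shiftedCorners.image Prod.fst ⊆ Finset.Icc 1 p.parts.card := by
    intro r hr
    obtain ⟨⟨a, b⟩, h, rfl⟩ := Finset.mem_image.1 hr
    have := (mem_shiftedCorners hp).1 h
    exact Finset.mem_Icc.2 ⟨this.1, this.2.1⟩
  rw [Finset.sum_subset hsub fun r hr h => hz r h (Finset.mem_Icc.1 hr).1 (Finset.mem_Icc.1 hr).2]
  symm
  refine Finset.sum_subset (Finset.Icc_subset_Icc_left hm) fun r hr h => ?_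
  rw [rowWeight, if_neg]
  simp only [Finset.mem_Icc] at hr h
  omega

/-! ### Hook ratios along the row and columns of a corner -/

/-- Columns from `ℓ` on are grouped by the lowest row meeting them. Within a group the hook lengths
of row `r` drop by one per column, so the ratios telescope. The induction runs upwards from row `ℓ`,
with a free endpoint `b` in the group of `k`. -/
theorem prod_Ico_card_hook_div {p : n.Partition} (hp : p.parts.Nodup) {r k : ℕ} (hr : 1 ≤ r)
    (hrk : r ≤ k) (hk : k ≤ p.parts.card) : ∀ {b : ℕ}, p.parts.card ≤ b → b ≤ p.nthPart k + k →
    b < p.nthPart r + k → (k < p.parts.card → p.nthPart (k + 1) + (k + 1) ≤ b) →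
    ∏ j ∈ Finset.Ico p.parts.card b,
        ((p.shiftedHookLength r j : ℚ) / (p.shiftedHookLength r j - 1)) =
      p.nthPart r / (p.nthPart r + k - b) *
        ∏ m ∈ Finset.Ioc k p.parts.card,
          (((p.nthPart r : ℚ) - p.nthPart m - 1) / (p.nthPart r - p.nthPart m)) := by
  have block : ∀ k b a : ℕ, r ≤ k → k ≤ p.parts.card → p.parts.card ≤ a → a ≤ b →
      b ≤ p.nthPart k + k → b < p.nthPart r + k →
      (k < p.parts.card → p.nthPart (k + 1) + (k + 1) ≤ a) →
      ∏ j ∈ Finset.Ico a b,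
        ((p.shiftedHookLength r j : ℚ) / (p.shiftedHookLength r j - 1)) =
      ((p.nthPart r : ℚ) + k - a) / (p.nthPart r + k - b) := by
    intro k b a hrk hk hla hab hbk hbr hlow
    rw [← Finset.prod_Ico_sub_div hab (by exact_mod_cast hbr)]
    refine Finset.prod_congr rfl fun j hj => ?_
    rw [Finset.mem_Ico] at hj
    rw [shiftedHookLength_of_card_le hp hr hrk hk (by omega) (by omega)
      fun h => (hlow h).trans hj.1]
    push_cast
    rfl
  induction hk using Nat.decreasingInduction with
  | self =>
    intro b h1 h2 h3 h4
    rw [block _ b _ hrk le_rfl le_rfl h1 h2 h3 (by omega)]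
    simp
  | of_succ k hk ih =>
    intro b h1 h2 h3 h4
    have hk1 := nthPart_lt hp (i := r) (j := k + 1) hr (by omega) hk
    have hc := card_lt_nthPart_add hp (i := k + 1) (by omega) hk
    have hne : (p.nthPart r : ℚ) - p.nthPart (k + 1) ≠ 0 :=
      sub_ne_zero.2 (by exact_mod_cast hk1.ne')
    have ih' := ih (by omega) (b := p.nthPart (k + 1) + (k + 1)) hc.le le_rfl (by omega) (by
      intro h
      have := nthPart_add_le hp (i := k + 1) (j := k + 1 + 1) (by omega) (by omega) h
      exact this)
    rw [← Finset.prod_Ico_consecutive _ hc.le (h4 hk), ih',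
      block k b _ hrk hk.le hc.le (h4 hk) h2 h3 (fun _ => le_rfl),
      ← Finset.insert_Ioc_add_one_left_eq_Ioc hk, Finset.prod_insert (by simp)]
    push_cast
    have e1 : (p.nthPart r : ℚ) + (k + 1) - (p.nthPart (k + 1) + (k + 1)) =
      p.nthPart r - p.nthPart (k + 1) := by ring
    have e2 : (p.nthPart r : ℚ) + k - (p.nthPart (k + 1) + (k + 1)) =
      p.nthPart r - p.nthPart (k + 1) - 1 := by ring
    rw [e1, e2]
    ring

/-- Columns `j < ℓ` supply the factors `(λ_r + λ_m) / (λ_r + λ_m - 1)` with `m = j + 1`, and columns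
from `ℓ` on supply the factors in `λ_r - λ_m` together with `λ_r`. -/
theorem prod_Icc_hook_div {p : n.Partition} (hp : p.parts.Nodup) {r s : ℕ}
    (hc : (r, s) ∈ p.shiftedCorners) :
    ∏ j ∈ Finset.Icc r (s - 1),
        ((p.shiftedHookLength r j : ℚ) / (p.shiftedHookLength r j - 1)) =
      p.nthPart r * ∏ m ∈ Finset.Ioc r p.parts.card, p.rowFactor m r := by
  obtain ⟨h1, h2, h3, h4⟩ := (mem_shiftedCorners hp).1 hc
  have hpos := nthPart_pos h1 h2
  have hcard := card_lt_nthPart_add hp h1 h2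
  have hs : Finset.Icc r (s - 1) = Finset.Ico r s := by
    ext j
    simp only [Finset.mem_Icc, Finset.mem_Ico]
    omega
  rw [hs, ← Finset.prod_Ico_consecutive _ h2 (by omega : p.parts.card ≤ s),
    prod_Ico_card_hook_div hp h1 le_rfl h2 (by omega) (by omega) (by omega) (by
      intro h
      have := h4 h
      omega)]
  have e : (p.nthPart r : ℚ) + r - s = 1 := by
    have : (s : ℚ) + 1 = p.nthPart r + r := by exact_mod_cast h3
    linarith
  have hI : Finset.Ioc r p.parts.card = Finset.Ico (r + 1) (p.parts.card + 1) := by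
    ext j
    simp only [Finset.mem_Ioc, Finset.mem_Ico]
    omega
  rw [e, div_one, mul_left_comm]
  congr 1
  rw [hI, Finset.prod_Ico_add' (fun m => ((p.nthPart r : ℚ) - p.nthPart m - 1) /
      (p.nthPart r - p.nthPart m)) r p.parts.card 1 |>.symm,
    Finset.prod_Ico_add' (fun m => p.rowFactor m r) r p.parts.card 1 |>.symm,
    ← Finset.prod_mul_distrib]
  refine Finset.prod_congr rfl fun j hj => ?_
  rw [Finset.mem_Ico] at hj
  rw [shiftedHookLength_of_lt_card hp h1 hj.1 hj.2, rowFactor]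
  obtain ⟨n1, n2⟩ := sub_mul_add_sub_one_ne_zero (nthPart_pos (p := p) (i := j + 1) (by omega) hj.2)
    hpos (nthPart_lt hp h1 (by omega : r < j + 1) hj.2).ne
  have n3 : (p.nthPart r : ℚ) - p.nthPart (j + 1) ≠ 0 := by
    rw [← neg_sub]; exact neg_ne_zero.2 n1
  have n4 : (p.nthPart r : ℚ) + p.nthPart (j + 1) - 1 ≠ 0 := by
    rw [add_comm]; exact n2
  push_cast
  rw [_root_.div_mul_div_comm, _root_.div_eq_div_iff (mul_ne_zero n4 n3) (mul_ne_zero n1 n2)]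
  ring

theorem shiftedHookLength_corner_column {p : n.Partition} (hp : p.parts.Nodup) {r s i : ℕ}
    (hc : (r, s) ∈ p.shiftedCorners) (hi : 1 ≤ i) (hir : i ≤ r) :
    p.shiftedHookLength i s = p.nthPart i - p.nthPart r + 1 := by
  obtain ⟨h1, h2, h3, h4⟩ := (mem_shiftedCorners hp).1 hc
  have hcard := card_lt_nthPart_add hp h1 h2
  rw [shiftedHookLength_of_card_le hp hi hir h2 (by omega) (by omega)
    (fun h => by have := h4 h; omega)]
  have : (s : ℤ) + 1 = p.nthPart r + r := by exact_mod_cast h3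
  linarith

theorem shiftedHookLength_pred_column {p : n.Partition} (hp : p.parts.Nodup) {r i : ℕ}
    (hr : r ≤ p.parts.card) (hi : 1 ≤ i) (hir : i < r) :
    p.shiftedHookLength i (r - 1) = p.nthPart i + p.nthPart r := by
  rw [shiftedHookLength_of_lt_card hp hi (by omega) (by omega), Nat.sub_add_cancel (by omega)]

/-- Replacing `h - 1` by `h` in the row and the columns of a corner multiplies by its weight. -/
theorem prod_hook_eq_rowWeight_mul {p : n.Partition} (hp : p.parts.Nodup) {r s m : ℕ}
    (hc : (r, s) ∈ p.shiftedCorners) (hm : 1 ≤ m) (hmr : m ≤ r) :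
    (∏ i ∈ Finset.Icc m (r - 1), (p.shiftedHookLength i s : ℚ)) *
      (∏ j ∈ Finset.Icc r (s - 1), (p.shiftedHookLength r j : ℚ)) *
      (∏ i ∈ Finset.Icc m (r - 1), (p.shiftedHookLength i (r - 1) : ℚ)) =
    p.rowWeight m r *
      ((∏ i ∈ Finset.Icc m (r - 1), ((p.shiftedHookLength i s : ℚ) - 1)) *
      (∏ j ∈ Finset.Icc r (s - 1), ((p.shiftedHookLength r j : ℚ) - 1)) *
      (∏ i ∈ Finset.Icc m (r - 1), ((p.shiftedHookLength i (r - 1) : ℚ) - 1))) := by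
  obtain ⟨h1, h2, h3, h4⟩ := (mem_shiftedCorners hp).1 hc
  have hrow : ∏ j ∈ Finset.Icc r (s - 1), ((p.shiftedHookLength r j : ℚ) - 1) ≠ 0 := by
    refine Finset.prod_ne_zero_iff.2 fun j hj => ?_
    rw [Finset.mem_Icc] at hj
    have := nthPart_pos h1 h2
    have := one_lt_shiftedHookLength (p := p) (i := r) (j := j)
      (mem_shiftedDiagram.2 (by omega)) (mem_shiftedDiagram.2 (by omega))
    exact sub_ne_zero.2 (by exact_mod_cast this.ne')
  have hR := prod_Icc_hook_div hp hc
  rw [Finset.prod_div_distrib, div_eq_iff hrow] at hR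
  -- In row `i < r` the two hook lengths are `λ_i - λ_r + 1` and `λ_i + λ_r`, whose ratios multiply
  -- to the factor of row `i`.
  have hcol : (∏ i ∈ Finset.Icc m (r - 1), (p.shiftedHookLength i s : ℚ)) *
        (∏ i ∈ Finset.Icc m (r - 1), (p.shiftedHookLength i (r - 1) : ℚ)) =
      (∏ i ∈ Finset.Icc m (r - 1), p.rowFactor i r) *
        ((∏ i ∈ Finset.Icc m (r - 1), ((p.shiftedHookLength i s : ℚ) - 1)) *
        (∏ i ∈ Finset.Icc m (r - 1), ((p.shiftedHookLength i (r - 1) : ℚ) - 1))) := by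
    simp only [← Finset.prod_mul_distrib]
    refine Finset.prod_congr rfl fun i hi => ?_
    rw [Finset.mem_Icc] at hi
    have hir : i < r := by omega
    rw [shiftedHookLength_corner_column hp hc (by omega) hir.le,
      shiftedHookLength_pred_column hp h2 (by omega) hir, rowFactor]
    obtain ⟨n1, n2⟩ := sub_mul_add_sub_one_ne_zero
      (nthPart_pos (p := p) (i := i) (by omega) (by omega)) (nthPart_pos h1 h2)
      (nthPart_lt hp (by omega) hir h2).ne'
    push_cast
    field_simp
    ring
  have hI : (Finset.Icc m p.parts.card).erase r =
      Finset.Icc m (r - 1) ∪ Finset.Ioc r p.parts.card := by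
    ext j
    simp only [Finset.mem_erase, Finset.mem_Icc, Finset.mem_union, Finset.mem_Ioc]
    omega
  have hd : Disjoint (Finset.Icc m (r - 1)) (Finset.Ioc r p.parts.card) := by
    rw [Finset.disjoint_left]
    intro j hj hj'
    rw [Finset.mem_Icc] at hj
    rw [Finset.mem_Ioc] at hj'
    omega
  rw [mul_right_comm, hcol, hR, rowWeight, if_pos hmr, hI, Finset.prod_union hd]
  ring

theorem cast_puncturedProd_eq {p : n.Partition} (hp : p.parts.Nodup) {r s : ℕ}
    (hc : (r, s) ∈ p.shiftedCorners) :
    (p.puncturedProd : ℚ) = p.puncturedProdAway r s *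
      ((∏ i ∈ Finset.Icc 1 (r - 1), ((p.shiftedHookLength i s : ℚ) - 1)) *
      (∏ j ∈ Finset.Icc r (s - 1), ((p.shiftedHookLength r j : ℚ) - 1)) *
      (∏ i ∈ Finset.Icc 1 (r - 1), ((p.shiftedHookLength i (r - 1) : ℚ) - 1))) := by
  rw [puncturedProd_eq hp hc]
  push_cast
  ring

/-! ### Corner terms of the three identities -/

theorem hookTerm_eq {p : n.Partition} (hp : p.parts.Nodup) {r s : ℕ}
    (hc : (r, s) ∈ p.shiftedCorners) :
    (p.puncturedProdAway r s *
        (∏ i ∈ Finset.Icc 1 (r - 1), (p.shiftedHookLength i s : ℚ)) *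
        (∏ j ∈ Finset.Icc r (s - 1), (p.shiftedHookLength r j : ℚ)) *
        (∏ i ∈ Finset.Icc 1 (r - 1), (p.shiftedHookLength i (r - 1) : ℚ))) =
      p.puncturedProd * p.rowWeight 1 r := by
  have h := prod_hook_eq_rowWeight_mul hp hc le_rfl ((mem_shiftedCorners hp).1 hc).1
  rw [cast_puncturedProd_eq hp hc]
  linear_combination (p.puncturedProdAway r s : ℚ) * h

theorem prod_Icc_eq_mul {f : ℕ → ℚ} {a b : ℕ} (h : a ≤ b) :
    ∏ i ∈ Finset.Icc a b, f i = f a * ∏ i ∈ Finset.Icc (a + 1) b, f i := by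
  rw [← Finset.insert_Icc_add_one_left_eq_Icc h, Finset.prod_insert (by simp)]

theorem shiftedHookLength_eq_one {p : n.Partition} {i j : ℕ} (h : j < i) :
    p.shiftedHookLength i j = 1 := by
  rw [shiftedHookLength, if_neg]
  rw [mem_shiftedDiagram]
  omega

/-- The coefficient comes from `A B - (A - 1)(B - 1) = A + B - 1`, where `A` and `B` are the row `1`
hook lengths in columns `s` and `r - 1`. -/
theorem hookTerm_first_eq {p : n.Partition} (hp : p.parts.Nodup) {r s : ℕ}
    (hc : (r, s) ∈ p.shiftedCorners) :
    (((p.shiftedHookLength 1 (r - 1) : ℚ) + p.shiftedHookLength 1 s - 1) *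
        p.puncturedProdAway r s *
        (∏ i ∈ Finset.Icc 2 (r - 1), (p.shiftedHookLength i s : ℚ)) *
        (∏ j ∈ Finset.Icc r (s - 1), (p.shiftedHookLength r j : ℚ)) *
        (∏ i ∈ Finset.Icc 2 (r - 1), (p.shiftedHookLength i (r - 1) : ℚ))) =
      p.puncturedProd * (p.rowWeight 1 r - p.rowWeight 2 r) := by
  have h1 := hookTerm_eq hp hc
  rw [mul_sub, ← h1]
  obtain ⟨hr, hrl, -, -⟩ := (mem_shiftedCorners hp).1 hc
  rcases hr.eq_or_lt with rfl | hr
  · have e := shiftedHookLength_corner_column hp hc le_rfl le_rfl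
    rw [sub_self, zero_add] at e
    rw [e, shiftedHookLength_eq_one (by omega), rowWeight, if_neg (by omega)]
    simp
  · have h2 := prod_hook_eq_rowWeight_mul hp hc one_le_two hr
    rw [cast_puncturedProd_eq hp hc]
    simp only [prod_Icc_eq_mul (show 1 ≤ r - 1 by omega)]
    linear_combination (-(p.puncturedProdAway r s : ℚ) * (p.shiftedHookLength 1 s - 1) *
      (p.shiftedHookLength 1 (r - 1) - 1)) * h2

/-- For `r ≥ 3`, the product of the four hook lengths in rows `1`, `2` and columns `s`, `r - 1`,
minus the product of the same lengths lowered by one, is `λ_1 + λ_2` times the coefficient. Corners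
in rows `1` and `2` have weight `0` for `m = 3` and are treated directly. -/
theorem hookTerm_first_second_eq {p : n.Partition} (hp : p.parts.Nodup) {r s : ℕ}
    (hc : (r, s) ∈ p.shiftedCorners) :
    ((p.nthPart 1 : ℚ) + p.nthPart 2) *
      (((p.shiftedHookLength 1 s : ℚ) * p.shiftedHookLength 2 (r - 1) +
          (p.shiftedHookLength 1 (r - 1) - 1) * (p.shiftedHookLength 2 s - 1)) *
        p.puncturedProdAway r s *
        (∏ i ∈ Finset.Icc 3 (r - 1), (p.shiftedHookLength i s : ℚ)) *
        (∏ j ∈ Finset.Icc (max r 2) (s - 1), (p.shiftedHookLength r j : ℚ)) *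
        (∏ i ∈ Finset.Icc 3 (r - 1), (p.shiftedHookLength i (r - 1) : ℚ))) =
      p.puncturedProd * (p.rowWeight 1 r - p.rowWeight 3 r) := by
  have h1 := hookTerm_eq hp hc
  rw [mul_sub (p.puncturedProd : ℚ), ← h1]
  obtain ⟨hr, hrl, hs, hlow⟩ := (mem_shiftedCorners hp).1 hc
  obtain rfl | rfl | hr3 : r = 1 ∨ r = 2 ∨ 3 ≤ r := by omega
  · have e := shiftedHookLength_corner_column hp hc le_rfl le_rfl
    rw [sub_self, zero_add] at e
    -- The factor `j = 1` omitted by `max r 2` is `h*_{11} = λ_1 + λ_2`, where `λ_2 = 0` if there is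
    -- one row. If `s = 1`, both products are empty and `λ_1 + λ_2 = 1`.
    have hsplit : ((p.nthPart 1 : ℚ) + p.nthPart 2) *
        ∏ j ∈ Finset.Icc 2 (s - 1), (p.shiftedHookLength 1 j : ℚ) =
        ∏ j ∈ Finset.Icc 1 (s - 1), (p.shiftedHookLength 1 j : ℚ) := by
      rcases hrl.eq_or_lt with hl | hl
      · have h20 : p.nthPart 2 = 0 := nthPart_of_card_lt (by omega)
        have hpos := nthPart_pos (p := p) le_rfl hrl
        by_cases hs1 : s = 1
        · have h11 : p.nthPart 1 = 1 := by omega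
          subst hs1
          simp [h20, h11]
        · rw [prod_Icc_eq_mul (show 1 ≤ s - 1 by omega),
            shiftedHookLength_of_card_le hp (k := 1) le_rfl le_rfl hrl hl.ge (by omega) (by omega),
            h20]
          push_cast
          ring
      · have := hlow hl
        rw [prod_Icc_eq_mul (show 1 ≤ s - 1 by omega),
          shiftedHookLength_of_lt_card hp le_rfl le_rfl hl]
        push_cast
        ring
    rw [e, shiftedHookLength_eq_one (show 1 - 1 < 1 by omega),
      shiftedHookLength_eq_one (show 1 - 1 < 2 by omega), rowWeight, if_neg (by omega),
      show max 1 2 = 2 from rfl]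
    simp only [show Finset.Icc 3 (1 - 1) = ∅ from rfl, show Finset.Icc 1 (1 - 1) = ∅ from rfl,
      Finset.prod_empty]
    push_cast
    linear_combination (p.puncturedProdAway 1 s : ℚ) * hsplit
  -- Here `h*_{2s} = 1` kills the second summand, `h*_{21} = 1` by convention, and `λ_1 + λ_2 =
  -- h*_{11}` is the missing factor of column `r - 1 = 1`.
  · have e := shiftedHookLength_corner_column hp hc one_le_two le_rfl
    rw [sub_self, zero_add] at e
    have e11 := shiftedHookLength_pred_column hp hrl le_rfl one_lt_two
    rw [e, shiftedHookLength_eq_one (show 2 - 1 < 2 by omega), rowWeight, if_neg (by omega),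
      max_self]
    simp only [show Finset.Icc 3 (2 - 1) = ∅ from rfl, show Finset.Icc 1 (2 - 1) = {1} from rfl,
      Finset.prod_empty, Finset.prod_singleton, e11]
    push_cast
    ring
  · have h3 := prod_hook_eq_rowWeight_mul hp hc (m := 3) (by omega) hr3
    rw [cast_puncturedProd_eq hp hc, max_eq_left (by omega : 2 ≤ r)]
    simp only [prod_Icc_eq_mul (show 1 ≤ r - 1 by omega), one_add_one_eq_two,
      prod_Icc_eq_mul (show 2 ≤ r - 1 by omega)]
    rw [shiftedHookLength_corner_column hp hc (i := 1) le_rfl hr,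
      shiftedHookLength_corner_column hp hc (i := 2) (by omega) (by omega),
      shiftedHookLength_pred_column hp hrl (i := 1) le_rfl (by omega),
      shiftedHookLength_pred_column hp hrl (i := 2) (by omega) (by omega)]
    push_cast
    linear_combination (-(p.puncturedProdAway r s : ℚ) * (p.nthPart 1 - p.nthPart r) *
      (p.nthPart 2 - p.nthPart r) * (p.nthPart 1 + p.nthPart r - 1) *
      (p.nthPart 2 + p.nthPart r - 1)) * h3

end Nat.Partition

/-! ### The three identities -/

theorem mainTheorem2 (n : ℕ) (hn : 1 ≤ n) (p : n.Partition) (hp : p.parts.Nodup) :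
    (n : ℤ) * p.puncturedProd =
        ∑ c ∈ p.shiftedCorners,
          p.puncturedProdAway c.1 c.2 *
            (∏ i ∈ Finset.Icc 1 (c.1 - 1), p.shiftedHookLength i c.2) *
            (∏ j ∈ Finset.Icc c.1 (c.2 - 1), p.shiftedHookLength c.1 j) *
            (∏ i ∈ Finset.Icc 1 (c.1 - 1), p.shiftedHookLength i (c.1 - 1)) ∧
    (p.nthPart 1 : ℤ) * p.puncturedProd =
        ∑ c ∈ p.shiftedCorners,
          (p.shiftedHookLength 1 (c.1 - 1) + p.shiftedHookLength 1 c.2 - 1) *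
            p.puncturedProdAway c.1 c.2 *
            (∏ i ∈ Finset.Icc 2 (c.1 - 1), p.shiftedHookLength i c.2) *
            (∏ j ∈ Finset.Icc c.1 (c.2 - 1), p.shiftedHookLength c.1 j) *
            (∏ i ∈ Finset.Icc 2 (c.1 - 1), p.shiftedHookLength i (c.1 - 1)) ∧
    p.puncturedProd =
        ∑ c ∈ p.shiftedCorners,
          (p.shiftedHookLength 1 c.2 * p.shiftedHookLength 2 (c.1 - 1) +
              (p.shiftedHookLength 1 (c.1 - 1) - 1) * (p.shiftedHookLength 2 c.2 - 1)) *
            p.puncturedProdAway c.1 c.2 *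
            (∏ i ∈ Finset.Icc 3 (c.1 - 1), p.shiftedHookLength i c.2) *
            (∏ j ∈ Finset.Icc (max c.1 2) (c.2 - 1), p.shiftedHookLength c.1 j) *
            (∏ i ∈ Finset.Icc 3 (c.1 - 1), p.shiftedHookLength i (c.1 - 1)) := by
  have hl : 1 ≤ p.parts.card := by
    by_contra! h
    have := p.sum_nthPart
    rw [Finset.Icc_eq_empty (by omega), Finset.sum_empty] at this
    omega
  have hsum : (n : ℚ) = ∑ i ∈ Finset.Icc 1 p.parts.card, (p.nthPart i : ℚ) := by
    exact_mod_cast p.sum_nthPart.symm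
  have hsum2 : (n : ℚ) = p.nthPart 1 + ∑ i ∈ Finset.Icc 2 p.parts.card, (p.nthPart i : ℚ) := by
    rw [hsum, ← Finset.insert_Icc_add_one_left_eq_Icc hl, Finset.sum_insert (by simp)]
    rfl
  have hsum3 : (n : ℚ) = p.nthPart 1 + p.nthPart 2 +
      ∑ i ∈ Finset.Icc 3 p.parts.card, (p.nthPart i : ℚ) := by
    rw [hsum2, add_assoc]
    congr 1
    rcases hl.eq_or_lt with h | h
    · rw [← h, Nat.Partition.nthPart_of_card_lt (p := p) (i := 2) (by omega)]
      simp
    · rw [← Finset.insert_Icc_add_one_left_eq_Icc h, Finset.sum_insert (by simp)]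
      rfl
  have s1 := Nat.Partition.sum_shiftedCorners_rowWeight hp le_rfl
  have s2 := Nat.Partition.sum_shiftedCorners_rowWeight hp one_le_two
  have s3 := Nat.Partition.sum_shiftedCorners_rowWeight hp (m := 3) (by omega)
  rw [← hsum] at s1
  refine ⟨?_, ?_, ?_⟩
  · rw [← Int.cast_inj (α := ℚ)]
    push_cast
    rw [Finset.sum_congr rfl fun c hc => Nat.Partition.hookTerm_eq hp hc, ← Finset.mul_sum, s1]
    ring
  · rw [← Int.cast_inj (α := ℚ)]
    push_cast
    rw [Finset.sum_congr rfl fun c hc => Nat.Partition.hookTerm_first_eq hp hc, ← Finset.mul_sum,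
      Finset.sum_sub_distrib, s1, s2, hsum2]
    ring
  · have hpos : (0 : ℚ) < p.nthPart 1 := by exact_mod_cast Nat.Partition.nthPart_pos le_rfl hl
    have hne : (p.nthPart 1 : ℚ) + p.nthPart 2 ≠ 0 := by positivity
    rw [← Int.cast_inj (α := ℚ)]
    push_cast
    apply mul_left_cancel₀ hne
    rw [Finset.mul_sum, Finset.sum_congr rfl fun c hc =>
      Nat.Partition.hookTerm_first_second_eq hp hc, ← Finset.mul_sum, Finset.sum_sub_distrib,
      s1, s3, hsum3]
    ring
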